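/- For a commutative ring $A$ with $1$, an integer $k \ge 1$ and $a_1,\dots,a_k \in A$, put \[M_k(a_1,\dots,a_k) = \begin{pmatrix} a_k & -1 \\ 1 & 0\end{pmatrix}\begin{pmatrix} a_{k-1} & -1 \\ 1 & 0\end{pmatrix}\cdots\begin{pmatrix} a_1 & -1 \\ 1 & 0\end{pmatrix},\] and, for an invertible element $u$ of $A$, where $A$ is finite, let $w_k^u(A)$ be the number of $k$-tuples $(a_1,\dots,a_k)\in A^k$ with $M_k(a_1,\dots,a_k)=\begin{pmatrix} u & 0 \\ 0 & u^{-1}\end{pmatrix}$. (The tuples with $M_k(a_1,\dots,a_k)=\pm \mathrm{Id}$ are the $\lambda$-quiddities of size $k$ over $A$.) i) Let $p$ be an odd prime number, $m\ge 2$ and $n=2l\ge 4$, with $l$ and $m$ integers. If $l$ is even, then \[w_{n+2}^{\overline{1}}(\mathbb{Z}/p^{m}\mathbb{Z})=\frac{p^{(m-1)(n-1)}(p^{l+1}-1)(p^{l}-1)}{p^{2}-1},\] \[w_{n+2}^{\overline{-1}}(\mathbb{Z}/p^{m}\mathbb{Z})=p^{(m-1)(n-1)}\left(\frac{(p^{l+1}-1)(p^{l}-1)}{p^{2}-1}+p^{l}\right)+\frac{p^{(m-1)(n-1-l)}-1}{p^{n-1-l}-1}\,p^{ml-1}(p-1).\]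 If $l$ is odd, then \[w_{n+2}^{\overline{1}}(\mathbb{Z}/p^{m}\mathbb{Z})=p^{(m-1)(n-1)}\left(\frac{(p^{l+1}-1)(p^{l}-1)}{p^{2}-1}+p^{l}\right)+\frac{p^{(m-1)(n-1-l)}-1}{p^{n-1-l}-1}\,p^{ml-1}(p-1),\] \[w_{n+2}^{\overline{-1}}(\mathbb{Z}/p^{m}\mathbb{Z})=\frac{p^{(m-1)(n-1)}(p^{l+1}-1)(p^{l}-1)}{p^{2}-1}.\] ii) Let $m\ge 3$ and $n=2l\ge 4$, with $l$ and $m$ integers. If $l$ is even, then \[w_{n+2}^{\overline{1}}(\mathbb{Z}/2^{m}\mathbb{Z})=2^{(m-2)(n-1)}\,\frac{4^{n}-2^{n}}{3},\] \[w_{n+2}^{\overline{-1}}(\mathbb{Z}/2^{m}\mathbb{Z})=2^{(m-2)(n-1)}\,\frac{4^{n}+2^{n+1}}{3}+\frac{2^{(m-2)(n-1-l)}-1}{2^{n-1-l}-1}\,2^{ml-1}.\] If $l$ is odd, then \[w_{n+2}^{\overline{1}}(\mathbb{Z}/2^{m}\mathbb{Z})=2^{(m-2)(n-1)}\,\frac{4^{n}+2^{n+1}}{3}+\frac{2^{(m-2)(n-1-l)}-1}{2^{n-1-l}-1}\,2^{ml-1},\]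 \[w_{n+2}^{\overline{-1}}(\mathbb{Z}/2^{m}\mathbb{Z})=2^{(m-2)(n-1)}\,\frac{4^{n}-2^{n}}{3}.\] -/

import Mathlib

/-- The elementary matrix with rows `(x, -1)` and `(1, 0)`. -/
def elemMatrix {A : Type*} [CommRing A] (x : A) : Matrix (Fin 2) (Fin 2) A :=
  !![x, -1; 1, 0]

/-- The product `M_n(a_1, …, a_n) = E(a_n) E(a_{n-1}) ⋯ E(a_1)` with `E = elemMatrix`
(the last entry of the tuple stands leftmost). -/
def quiddityMatrix {A : Type*} [CommRing A] {n : ℕ} (a : Fin n → A) :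
    Matrix (Fin 2) (Fin 2) A :=
  ((List.ofFn a).reverse.map elemMatrix).prod

/-- The set of all `n`-tuples over `A` with `M_n(a_1, …, a_n) = B`. -/
def Omega (A : Type*) [CommRing A] (n : ℕ) (B : Matrix.SpecialLinearGroup (Fin 2) A) :
    Set (Fin n → A) :=
  {a | quiddityMatrix a = (B : Matrix (Fin 2) (Fin 2) A)}

/-- The diagonal matrix `diag(u, u⁻¹)` of determinant one, for an invertible element `u`. -/
def diagUnit {A : Type*} [CommRing A] (u : Aˣ) : Matrix.SpecialLinearGroup (Fin 2) A :=
  ⟨!![(u : A), 0; 0, ((u⁻¹ : Aˣ) : A)], by simp [Matrix.det_fin_two]⟩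

/-- `w n u` is the number of `n`-tuples over `A` with `M_n(a_1, …, a_n) = diag(u, u⁻¹)`. -/
noncomputable def w {A : Type*} [CommRing A] (n : ℕ) (u : Aˣ) : ℕ :=
  (Omega A n (diagUnit u)).ncard

/-! If `E(s) M E(r) = diag(u, u⁻¹)` with `det M = 1`, then `M` has corner `-u⁻¹`, and this corner
condition is also sufficient once `r` and `s` take their forced values. So `w (n + 2) u` counts
inner tuples by corner entry (`w_eq_topCount`).

Over a finite local ring with `N` elements and `q` non-units, two further letters `x, y` send the
first column `(α, β)` to one with corner `y (x α - β) - α`. If `α` is a unit, `x α - β` runs once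
through the ring; otherwise `β` is a unit, and so is every `x α - β`. Hence `topCount` obeys a
recursion in the corner alone (`topCount_add_two_eq_sum`). It resembles the convolution recursion of
`dotCount`, up to a sign at each step, and differs only at non-units, where all the factors involved
are constant. Therefore `topCount (2 * l)` at `(-1) ^ l * e`, `e` a unit, is `dotCount l (e - 1)`
plus an explicit constant (`topCount_two_mul`).

Over `ZMod (p ^ m)`, `dotCount` is found by sorting the vectors `x` by the largest power of `p`
dividing all coordinates (`ZMod.dotCount_prime_pow`). The cases `u = ±1` need only its values at `0`
and `-2`. The latter is a unit for odd `p` but not for `p = 2`, whence the two families of formulas.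
-/

/-- The number of `n`-tuples whose quiddity matrix has upper left entry `t`. -/
noncomputable def topCount {A : Type*} [CommRing A] [Fintype A] [DecidableEq A]
    (n : ℕ) (t : A) : ℚ :=
  ∑ b : Fin n → A, if quiddityMatrix b 0 0 = t then 1 else 0

/-- The number of pairs of vectors of length `l` with dot product `t`. -/
noncomputable def dotCount {A : Type*} [CommRing A] [Fintype A] [DecidableEq A]
    (l : ℕ) (t : A) : ℚ :=
  ∑ x : Fin l → A, ∑ y : Fin l → A, if ∑ i, x i * y i = t then 1 else 0

/-- The number of factorizations `t = x * y`. -/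
noncomputable def mulCount {A : Type*} [CommRing A] [Fintype A] [DecidableEq A] (t : A) : ℚ :=
  ∑ x : A, ∑ y : A, if x * y = t then 1 else 0

/-! ### Reduction to the corner entry -/

section QuiddityMatrix

variable {A : Type*} [CommRing A]

theorem quiddityMatrix_snoc {n : ℕ} (b : Fin n → A) (x : A) :
    quiddityMatrix (Fin.snoc b x : Fin (n + 1) → A) = elemMatrix x * quiddityMatrix b := by
  rw [quiddityMatrix, List.ofFn_succ_last]
  simp [quiddityMatrix]

theorem quiddityMatrix_cons {n : ℕ} (b : Fin n → A) (x : A) :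
    quiddityMatrix (Fin.cons x b : Fin (n + 1) → A) = quiddityMatrix b * elemMatrix x := by
  simp [quiddityMatrix, List.ofFn_succ]

theorem det_quiddityMatrix {n : ℕ} (b : Fin n → A) : (quiddityMatrix b).det = 1 := by
  induction n with
  | zero => simp [quiddityMatrix]
  | succ n ih =>
    rw [← Fin.cons_self_tail b, quiddityMatrix_cons, Matrix.det_mul, ih]
    simp [elemMatrix, Matrix.det_fin_two]

theorem elemMatrix_mul_mul_eq_diagUnit_iff (u : Aˣ) (r s : A) (M : Matrix (Fin 2) (Fin 2) A)
    (hM : M.det = 1) :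
    elemMatrix s * (M * elemMatrix r) = (diagUnit u : Matrix (Fin 2) (Fin 2) A) ↔
      M 0 0 = -((u⁻¹ : Aˣ) : A) ∧ r = u * M 0 1 ∧ s = -(u * M 1 0) := by
  have hu : (u : A) * ((u⁻¹ : Aˣ) : A) = 1 := u.mul_inv
  rw [Matrix.det_fin_two] at hM
  have key : elemMatrix s * (M * elemMatrix r) =
      !![s * (M 0 0 * r + M 0 1) - (M 1 0 * r + M 1 1), -(s * M 0 0) + M 1 0;
        M 0 0 * r + M 0 1, -M 0 0] := by
    ext i j
    fin_cases i <;> fin_cases j <;> simp [elemMatrix, Matrix.mul_apply, Fin.sum_univ_two] <;> ring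
  rw [key, diagUnit]
  constructor
  · intro h
    have h00 := congrFun (congrFun h 0) 0
    have h01 := congrFun (congrFun h 0) 1
    have h10 := congrFun (congrFun h 1) 0
    have h11 := congrFun (congrFun h 1) 1
    simp at h00 h01 h10 h11
    refine ⟨by linear_combination -h11, ?_, ?_⟩
    · linear_combination -u * h10 - u * r * h11 - r * hu
    · linear_combination u * h01 - u * s * h11 - s * hu
  · rintro ⟨h1, h2, h3⟩
    have e1 : M 0 0 * r + M 0 1 = 0 := by
      rw [h2, h1]; linear_combination -M 0 1 * hu
    have e2 : -(s * M 0 0) + M 1 0 = 0 := by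
      rw [h3, h1]; linear_combination -M 1 0 * hu
    have e3 : -(M 1 0 * r + M 1 1) = u := by
      rw [h2]; linear_combination u * hM - u * M 1 1 * h1 + M 1 1 * hu
    rw [e1, e2, h1, mul_zero, zero_sub, e3, neg_neg]

variable [Fintype A] [DecidableEq A]

/-- Deleting the first and last letters is a bijection, since both are determined by the inner
tuple. -/
theorem w_eq_topCount (n : ℕ) (u : Aˣ) :
    (w (n + 2) u : ℚ) = topCount n (-((u⁻¹ : Aˣ) : A)) := by
  classical
  have hsum : topCount n (-((u⁻¹ : Aˣ) : A)) =
      ((Finset.univ.filter fun b : Fin n → A =>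
        quiddityMatrix b 0 0 = -((u⁻¹ : Aˣ) : A)).card : ℚ) := by
    simp [topCount]
  have hiff : ∀ a : Fin (n + 2) → A, a ∈ Omega A (n + 2) (diagUnit u) ↔
      quiddityMatrix (Fin.init (Fin.tail a)) 0 0 = -((u⁻¹ : Aˣ) : A) ∧
        a 0 = u * quiddityMatrix (Fin.init (Fin.tail a)) 0 1 ∧
        a (Fin.last (n + 1)) = -(u * quiddityMatrix (Fin.init (Fin.tail a)) 1 0) := fun a => by
    have ha : a = Fin.cons (a 0) (Fin.snoc (Fin.init (Fin.tail a)) (a (Fin.last (n + 1)))) := by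
      conv_lhs => rw [← Fin.cons_self_tail a, ← Fin.snoc_init_self (Fin.tail a)]
      rfl
    have hq : quiddityMatrix a = elemMatrix (a (Fin.last (n + 1))) *
        (quiddityMatrix (Fin.init (Fin.tail a)) * elemMatrix (a 0)) := by
      conv_lhs => rw [ha, quiddityMatrix_cons, quiddityMatrix_snoc, Matrix.mul_assoc]
    rw [Omega, Set.mem_ofPred_eq, hq]
    exact elemMatrix_mul_mul_eq_diagUnit_iff u _ _ _ (det_quiddityMatrix _)
  rw [hsum, w, Nat.cast_inj, ← Set.ncard_coe_finset]
  refine Set.ncard_congr (fun a _ => Fin.init (Fin.tail a)) ?_ ?_ ?_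
  · intro a ha
    simpa using ((hiff a).1 ha).1
  · intro a b ha hb hab
    obtain ⟨-, h1, h2⟩ := (hiff a).1 ha
    obtain ⟨-, h3, h4⟩ := (hiff b).1 hb
    rw [← Fin.cons_self_tail a, ← Fin.cons_self_tail b, ← Fin.snoc_init_self (Fin.tail a),
      ← Fin.snoc_init_self (Fin.tail b), hab]
    have e0 : a 0 = b 0 := by rw [h1, h3, hab]
    have e1 : Fin.tail a (Fin.last n) = Fin.tail b (Fin.last n) := by
      change a (Fin.last (n + 1)) = b (Fin.last (n + 1))
      rw [h2, h4, hab]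
    rw [e0, e1]
  · intro b hb
    have hb' : quiddityMatrix b 0 0 = -((u⁻¹ : Aˣ) : A) := by simpa using hb
    refine ⟨Fin.cons (u * quiddityMatrix b 0 1) (Fin.snoc b (-(u * quiddityMatrix b 1 0))), ?_, ?_⟩
    · rw [hiff]
      simp only [Fin.tail_cons, Fin.init_snoc, Fin.cons_zero, true_and]
      refine ⟨hb', ?_⟩
      rw [← Fin.succ_last, Fin.cons_succ, Fin.snoc_last]
    · simp

end QuiddityMatrix

/-! ### One-step recursions over a finite commutative ring -/

section Step

variable {A : Type*} [CommRing A] [Fintype A] [DecidableEq A]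

theorem sum_mul_isUnit_eq {s : A} (hs : IsUnit s) (t : A) :
    ∑ y : A, (if y * s = t then (1 : ℚ) else 0) = 1 := by
  obtain ⟨u, rfl⟩ := hs
  have h : ∀ y : A, y * u = t ↔ y = t * ((u⁻¹ : Aˣ) : A) := fun y =>
    (Units.eq_mul_inv_iff_mul_eq u).symm
  simp [h]

theorem mulCount_neg (t : A) : mulCount (-t) = mulCount t := by
  unfold mulCount
  refine Fintype.sum_equiv (Equiv.neg A) _ _ fun x => Fintype.sum_congr _ _ fun y => ?_
  simp [neg_mul, eq_neg_iff_add_eq_zero, neg_eq_iff_add_eq_zero]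

theorem sum_sum_mul_add_of_isUnit {α : A} (hα : IsUnit α) (β t : A) :
    ∑ x : A, ∑ y : A, (if y * (x * α - β) - α = t then (1 : ℚ) else 0) = mulCount (t + α) := by
  obtain ⟨u, rfl⟩ := hα
  unfold mulCount
  -- The substitution `x ↦ x * α - β` is a bijection because `α` is a unit.
  refine Fintype.sum_equiv ((Units.mulRight u).trans (Equiv.subRight β)) _ _ fun x =>
    Fintype.sum_congr _ _ fun y => ?_
  simp [sub_eq_iff_eq_add, mul_comm y]

theorem sum_sum_mul_add_of_isUnit_sub {α β : A} (h : ∀ x : A, IsUnit (x * α - β)) (t : A) :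
    ∑ x : A, ∑ y : A, (if y * (x * α - β) - α = t then (1 : ℚ) else 0) = Fintype.card A := by
  have : ∀ x : A, ∑ y : A, (if y * (x * α - β) - α = t then (1 : ℚ) else 0) = 1 := fun x => by
    simpa only [sub_eq_iff_eq_add] using sum_mul_isUnit_eq (h x) (t + α)
  simp [this]

theorem topCount_add_two (n : ℕ) (t : A) :
    topCount (n + 2) t = ∑ b : Fin n → A, ∑ x : A, ∑ y : A,
      if y * (x * quiddityMatrix b 0 0 - quiddityMatrix b 1 0) - quiddityMatrix b 0 0 = t
        then (1 : ℚ) else 0 := by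
  have hs : ∀ (k : ℕ) (f : (Fin (k + 1) → A) → ℚ),
      ∑ b, f b = ∑ b : Fin k → A, ∑ x : A, f (Fin.snoc b x) := fun k f => by
    rw [← (Fin.snocEquiv fun _ => A).sum_comp, Fintype.sum_prod_type, Finset.sum_comm]
    rfl
  unfold topCount
  rw [hs, hs]
  refine Fintype.sum_congr _ _ fun b => Fintype.sum_congr _ _ fun x =>
    Fintype.sum_congr _ _ fun y => ?_
  rw [quiddityMatrix_snoc, quiddityMatrix_snoc]
  congr 2
  simp [elemMatrix, Matrix.vecMul, dotProduct, Fin.sum_univ_two]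
  ring

theorem sum_quiddityMatrix (n : ℕ) (g : A → ℚ) :
    ∑ b : Fin n → A, g (quiddityMatrix b 0 0) = ∑ a : A, topCount n a * g a := by
  simp only [topCount, Finset.sum_mul, ite_mul, one_mul, zero_mul]
  rw [Finset.sum_comm]
  simp

theorem sum_topCount (n : ℕ) : ∑ a : A, topCount n a = (Fintype.card A : ℚ) ^ n := by
  simpa using (sum_quiddityMatrix (A := A) n fun _ => 1).symm

theorem topCount_zero (t : A) : topCount 0 t = if t = 1 then (1 : ℚ) else 0 := by
  simp [topCount, quiddityMatrix, eq_comm]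

theorem dotCount_zero (t : A) : dotCount 0 t = if t = 0 then (1 : ℚ) else 0 := by
  simp [dotCount, eq_comm]

theorem dotCount_succ (l : ℕ) (t : A) :
    dotCount (l + 1) t = ∑ a : A, dotCount l a * mulCount (t - a) := by
  have hs : ∀ f : (Fin (l + 1) → A) → ℚ,
      ∑ b, f b = ∑ b : Fin l → A, ∑ x : A, f (Fin.cons x b) := fun f => by
    rw [← (Fin.consEquiv fun _ => A).sum_comp, Fintype.sum_prod_type, Finset.sum_comm]
    rfl
  have h2 : ∀ x y : Fin l → A, ∑ a : A, (if ∑ i, x i * y i = a then (1 : ℚ) else 0) *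
      mulCount (t - a) = mulCount (t - ∑ i, x i * y i) := fun x y => by simp
  have h3 : ∑ a : A, dotCount l a * mulCount (t - a) =
      ∑ x : Fin l → A, ∑ y : Fin l → A, mulCount (t - ∑ i, x i * y i) := by
    simp only [dotCount, Finset.sum_mul]
    rw [Finset.sum_comm]
    refine Fintype.sum_congr _ _ fun x => ?_
    rw [Finset.sum_comm]
    exact Fintype.sum_congr _ _ fun y => h2 x y
  rw [h3, dotCount, hs]
  refine Fintype.sum_congr _ _ fun x => ?_
  simp_rw [hs]
  rw [Finset.sum_comm]
  refine Fintype.sum_congr _ _ fun y => ?_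
  rw [mulCount]
  refine Fintype.sum_congr _ _ fun a => Fintype.sum_congr _ _ fun b => ?_
  simp [Fin.sum_univ_succ, eq_sub_iff_add_eq]

theorem sum_mulCount : ∑ a : A, mulCount a = (Fintype.card A : ℚ) ^ 2 := by
  unfold mulCount
  rw [Finset.sum_comm]
  conv_lhs => enter [2, x]; rw [Finset.sum_comm]
  simp [sq]

/-- The number of non-units of a finite ring. -/
noncomputable def nonunitCount (A : Type*) [CommRing A] [Fintype A] : ℚ :=
  ∑ a : A, open Classical in if IsUnit a then 0 else 1

theorem mulCount_of_isUnit {t : A} (ht : IsUnit t) :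
    mulCount t = (Fintype.card A : ℚ) - nonunitCount A := by
  classical
  have h : ∀ x : A, ∑ y : A, (if x * y = t then (1 : ℚ) else 0) =
      1 - if IsUnit x then 0 else 1 := fun x => by
    split_ifs with hx
    · simpa only [mul_comm x, sub_zero] using sum_mul_isUnit_eq hx t
    · rw [sub_self]
      refine Finset.sum_eq_zero fun y _ => if_neg fun h => hx ?_
      exact isUnit_of_mul_isUnit_left (h ▸ ht)
  simp only [mulCount, h, nonunitCount, Finset.sum_sub_distrib]
  simp
  exact Fintype.sum_congr _ _ fun x => by congr

end Step

/-! ### The corner recursion over a local ring -/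

section LocalRing

variable {A : Type*} [CommRing A] [IsLocalRing A] [Fintype A] [DecidableEq A]

theorem isUnit_add_of_not {a b : A} (ha : IsUnit a) (hb : ¬ IsUnit b) : IsUnit (a + b) := by
  by_contra h
  have h2 : ¬ IsUnit (-b) := by rwa [IsUnit.neg_iff]
  exact (IsLocalRing.nonunits_add h h2) (by simpa using ha)

open Classical in
theorem topCount_add_two_eq_sum (n : ℕ) (t : A) :
    topCount (n + 2) t = ∑ a : A, topCount n a *
      if IsUnit a then mulCount (t + a) else (Fintype.card A : ℚ) := by
  rw [topCount_add_two, ← sum_quiddityMatrix n fun a =>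
    if IsUnit a then mulCount (t + a) else (Fintype.card A : ℚ)]
  refine Fintype.sum_congr _ _ fun b => ?_
  split_ifs with h
  · exact sum_sum_mul_add_of_isUnit h _ _
  · refine sum_sum_mul_add_of_isUnit_sub (fun x => ?_) t
    have hdet := det_quiddityMatrix b
    rw [Matrix.det_fin_two] at hdet
    -- By `det = 1`, the product of the off-diagonal entries, negated, is `1` minus a non-unit; so
    -- the lower left entry is a unit.
    have h1 : IsUnit (1 + -(quiddityMatrix b 0 0 * quiddityMatrix b 1 1)) :=
      isUnit_add_of_not isUnit_one fun h' => h (isUnit_of_mul_isUnit_left (IsUnit.neg_iff _ |>.1 h'))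
    have h2 : IsUnit (quiddityMatrix b 1 0) := by
      refine isUnit_of_mul_isUnit_right (x := -quiddityMatrix b 0 1) ?_
      convert h1 using 1
      linear_combination hdet
    have h3 := isUnit_add_of_not h2.neg
      (fun h' => h (isUnit_of_mul_isUnit_right h') : ¬ IsUnit (x * quiddityMatrix b 0 0))
    rwa [neg_add_eq_sub] at h3

end LocalRing

/-! ### Counting solutions of a dot product equation -/

section DotCount

variable {A : Type*} [CommRing A] [Fintype A] [DecidableEq A]

-- The map `y ↦ x · y` is additive with image the ideal spanned by the `x i`, so all its nonempty
-- fibres have the same size.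
open Classical in
theorem sum_dot_eq {l : ℕ} (x : Fin l → A) (t : A) :
    ∑ y : Fin l → A, (if ∑ i, x i * y i = t then (1 : ℚ) else 0) =
      if t ∈ Ideal.span (Set.range x) then
        (Fintype.card A : ℚ) ^ l / Nat.card (Ideal.span (Set.range x)) else 0 := by
  have hmem : ∀ s, s ∈ Ideal.span (Set.range x) ↔ ∃ y : Fin l → A, ∑ i, x i * y i = s := fun s => by
    simp only [Ideal.mem_span_range_iff_exists_fun, mul_comm]
  set f : A → ℚ := fun s => ∑ y : Fin l → A, if ∑ i, x i * y i = s then (1 : ℚ) else 0 with hf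
  have hzero : ∀ s, s ∉ Ideal.span (Set.range x) → f s = 0 := fun s hs =>
    Finset.sum_eq_zero fun y _ => if_neg fun h => hs ((hmem s).2 ⟨y, h⟩)
  have hconst : ∀ s, s ∈ Ideal.span (Set.range x) → f s = f 0 := fun s hs => by
    obtain ⟨y₀, rfl⟩ := (hmem s).1 hs
    refine Fintype.sum_equiv (Equiv.subRight y₀) _ _ fun y => ?_
    simp [mul_sub, Finset.sum_sub_distrib, sub_eq_zero]
  have htot : ∑ s, f s = (Fintype.card A : ℚ) ^ l := by
    rw [hf, Finset.sum_comm]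
    simp
  have hcard : ∑ s, f s = Nat.card (Ideal.span (Set.range x)) * f 0 := by
    have : ∀ s, f s = if s ∈ Ideal.span (Set.range x) then f 0 else 0 := fun s => by
      split_ifs with h
      · exact hconst s h
      · exact hzero s h
    rw [Fintype.sum_congr _ _ this, ← Finset.sum_filter, Finset.sum_const, nsmul_eq_mul,
      Nat.card_eq_fintype_card, Fintype.card_subtype]
  have hpos : (Nat.card (Ideal.span (Set.range x)) : ℚ) ≠ 0 := by
    exact_mod_cast Nat.card_pos.ne'
  change f t = _
  split_ifs with h
  · rw [hconst t h, eq_div_iff hpos, ← htot, hcard, mul_comm]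
  · exact hzero t h

theorem nonunitCount_pow (l : ℕ) :
    nonunitCount A ^ l = ∑ x : Fin l → A, open Classical in if ∃ i, IsUnit (x i) then 0 else 1 := by
  classical
  rw [nonunitCount, Fintype.sum_pow]
  refine Fintype.sum_congr _ _ fun x => ?_
  split_ifs with h
  · obtain ⟨i, hi⟩ := h
    exact Finset.prod_eq_zero (Finset.mem_univ i) (if_pos hi)
  · push Not at h
    exact Finset.prod_eq_one fun i _ => if_neg (h i)

/-- A unit lies in the ideal spanned by `x` only if that ideal is the whole ring, which in a local
ring means that some `x i` is a unit. -/
theorem dotCount_of_isUnit [IsLocalRing A] (l : ℕ) {t : A} (ht : IsUnit t) :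
    dotCount l t = ((Fintype.card A : ℚ) ^ l - nonunitCount A ^ l) *
      ((Fintype.card A : ℚ) ^ l / Fintype.card A) := by
  classical
  have h : ∀ x : Fin l → A, ∑ y : Fin l → A, (if ∑ i, x i * y i = t then (1 : ℚ) else 0) =
      (1 - if ∃ i, IsUnit (x i) then 0 else 1) *
        ((Fintype.card A : ℚ) ^ l / Fintype.card A) := fun x => by
    rw [sum_dot_eq]
    by_cases hx : ∃ i, IsUnit (x i)
    · obtain ⟨i, hi⟩ := hx
      have htop : Ideal.span (Set.range x) = ⊤ :=
        Ideal.eq_top_of_isUnit_mem _ (Ideal.subset_span ⟨i, rfl⟩) hi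
      rw [htop, if_pos Submodule.mem_top, if_pos ⟨i, hi⟩, sub_zero, one_mul,
        ← Nat.card_eq_fintype_card]
      congr 2
      exact Nat.card_congr Submodule.topEquiv.toEquiv
    · rw [if_neg hx, sub_self, zero_mul, if_neg]
      intro hmem
      have hle : Ideal.span (Set.range x) ≤ IsLocalRing.maximalIdeal A := by
        rw [Ideal.span_le]
        rintro _ ⟨i, rfl⟩
        exact (IsLocalRing.mem_maximalIdeal _).2 fun hi => hx ⟨i, hi⟩
      exact (IsLocalRing.mem_maximalIdeal _).1 (hle hmem) ht
  rw [dotCount, Fintype.sum_congr _ _ h, ← Finset.sum_mul, Finset.sum_sub_distrib,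
    nonunitCount_pow]
  simp

theorem nonunitCount_nonneg : 0 ≤ nonunitCount A :=
  Finset.sum_nonneg fun a _ => by split_ifs <;> simp

theorem nonunitCount_lt_card : nonunitCount A < Fintype.card A := by
  classical
  have : (Fintype.card A : ℚ) = ∑ a : A, 1 := by simp
  rw [this, nonunitCount]
  refine Finset.sum_lt_sum (fun a _ => by split_ifs <;> simp) ⟨1, Finset.mem_univ _, by simp⟩

end DotCount

/-! ### Comparing corner counts with dot product counts -/

section TopCount

variable {A : Type*} [CommRing A] [IsLocalRing A] [Fintype A] [DecidableEq A]

theorem topCount_add_two_of_not_isUnit (n : ℕ) {z : ℚ}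
    (hz : ∀ a : A, ¬ IsUnit a → topCount n a = z) {t : A} (ht : ¬ IsUnit t) :
    topCount (n + 2) t =
      (Fintype.card A - nonunitCount A) * (Fintype.card A : ℚ) ^ n + nonunitCount A ^ 2 * z := by
  classical
  -- For unit `a` the factor is `N - q`; extending it to all `a` leaves a correction `q * z` at each
  -- non-unit.
  have h : ∀ a : A, (topCount n a * if IsUnit a then mulCount (t + a) else (Fintype.card A : ℚ)) =
      topCount n a * (Fintype.card A - nonunitCount A) +
        (if IsUnit a then 0 else 1) * (nonunitCount A * z) := fun a => by
    split_ifs with ha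
    · rw [add_comm t, mulCount_of_isUnit (isUnit_add_of_not ha ht)]; ring
    · rw [hz a ha]; ring
  have hq : ∑ a : A, (if IsUnit a then (0 : ℚ) else 1) = nonunitCount A := by
    unfold nonunitCount
    congr!
  have h' := Fintype.sum_congr _ _ h
  rw [Finset.sum_add_distrib, ← Finset.sum_mul, ← Finset.sum_mul, sum_topCount, hq] at h'
  rw [topCount_add_two_eq_sum]
  refine Eq.trans (by congr!) (h'.trans ?_)
  ring

/-- The sign changes from `s` to `-s` because the recursion has `mulCount (t + a)` where the
convolution has `mulCount (t - a)`. The last summand is the total correction at the `q` non-units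
`a`: there `a - 1` and `e - a` are units, so `dotCount` and `mulCount` take their constant unit
values. -/
theorem topCount_add_two_of_isUnit (n l : ℕ) {z u : ℚ} {s : A} (hs : s = 1 ∨ s = -1)
    (hz : ∀ a : A, ¬ IsUnit a → topCount n a = z)
    (hu : ∀ a : A, IsUnit a → topCount n (s * a) = dotCount l (a - 1) + u) {e : A}
    (he : IsUnit e) :
    topCount (n + 2) (-s * e) = dotCount (l + 1) (e - 1) + u * (Fintype.card A : ℚ) ^ 2 +
      nonunitCount A * (z * Fintype.card A - (((Fintype.card A : ℚ) ^ l - nonunitCount A ^ l) *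
      ((Fintype.card A : ℚ) ^ l / Fintype.card A) + u) * (Fintype.card A - nonunitCount A)) := by
  classical
  have hss : s * s = 1 := by rcases hs with rfl | rfl <;> simp
  have hsu : ∀ a : A, IsUnit (s * a) ↔ IsUnit a := fun a => by
    rcases hs with rfl | rfl <;> simp
  have hD : ∀ a : A, mulCount (-s * e + s * a) = mulCount (e - a) := fun a => by
    rcases hs with rfl | rfl
    · rw [← mulCount_neg]; congr 1; ring
    · congr 1; ring
  have hH : dotCount (l + 1) (e - 1) = ∑ a : A, dotCount l (a - 1) * mulCount (e - a) := by
    rw [dotCount_succ]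
    refine Fintype.sum_equiv (Equiv.addRight 1) _ _ fun a => ?_
    simp [sub_sub, add_comm a]
  have hM : ∑ a : A, mulCount (e - a) = (Fintype.card A : ℚ) ^ 2 := by
    rw [← sum_mulCount (A := A)]
    exact Fintype.sum_equiv (Equiv.subLeft e) _ _ fun a => rfl
  have h : ∀ a : A, (topCount n (s * a) *
      if IsUnit (s * a) then mulCount (-s * e + s * a) else (Fintype.card A : ℚ)) =
      dotCount l (a - 1) * mulCount (e - a) + u * mulCount (e - a) +
        (if IsUnit a then 0 else 1) * (z * Fintype.card A -
          (((Fintype.card A : ℚ) ^ l - nonunitCount A ^ l) *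
      ((Fintype.card A : ℚ) ^ l / Fintype.card A) + u) * (Fintype.card A - nonunitCount A)) :=
      fun a => by
    simp only [hsu, hD]
    split_ifs with ha
    · rw [hu a ha]; ring
    · have h1 : IsUnit (e - a) := by
        rw [sub_eq_add_neg]
        exact isUnit_add_of_not he (by rwa [IsUnit.neg_iff])
      have h2 : IsUnit (a - 1) := by
        rw [sub_eq_neg_add]
        exact isUnit_add_of_not isUnit_one.neg ha
      rw [hz _ (by rwa [hsu]), mulCount_of_isUnit h1, dotCount_of_isUnit l h2]; ring
  have hre : ∀ f : A → ℚ, ∑ a, f a = ∑ a, f (s * a) := fun f =>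
    (Fintype.sum_equiv ⟨(s * ·), (s * ·), fun a => by simp [← mul_assoc, hss],
      fun a => by simp [← mul_assoc, hss]⟩ _ _ fun a => rfl).symm
  have hq : ∑ a : A, (if IsUnit a then (0 : ℚ) else 1) = nonunitCount A := by
    unfold nonunitCount
    congr!
  have h' := Fintype.sum_congr _ _ h
  rw [Finset.sum_add_distrib, Finset.sum_add_distrib, ← Finset.sum_mul, ← Finset.mul_sum, hM,
    ← hH, hq] at h'
  rw [topCount_add_two_eq_sum, hre]
  exact Eq.trans (by congr!) h'

/-- Both parts go through one induction, since the value at units for `l + 1` uses the constant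
value at non-units for `l`. -/
theorem topCount_two_mul (l : ℕ) :
    (∀ t : A, ¬ IsUnit t → topCount (2 * l) t =
      ((Fintype.card A : ℚ) ^ (2 * l) - nonunitCount A ^ (2 * l)) /
        (Fintype.card A + nonunitCount A)) ∧
    ∀ e : A, IsUnit e → topCount (2 * l) ((-1) ^ l * e) = dotCount l (e - 1) +
      (((Fintype.card A : ℚ) ^ (l + 1) - nonunitCount A ^ (l + 1)) *
        ((Fintype.card A : ℚ) ^ l - nonunitCount A ^ l) /
          ((Fintype.card A : ℚ) ^ 2 - nonunitCount A ^ 2) -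
        ((Fintype.card A : ℚ) ^ l - nonunitCount A ^ l) *
          ((Fintype.card A : ℚ) ^ l / Fintype.card A)) := by
  have hq := nonunitCount_nonneg (A := A)
  have hqN := nonunitCount_lt_card (A := A)
  have hN : (Fintype.card A : ℚ) ≠ 0 := (hq.trans_lt hqN).ne'
  have hadd : (Fintype.card A : ℚ) + nonunitCount A ≠ 0 := by linarith [hq.trans_lt hqN]
  have hsub : (Fintype.card A : ℚ) - nonunitCount A ≠ 0 := by linarith
  have hsq : (Fintype.card A : ℚ) ^ 2 - nonunitCount A ^ 2 =
      (Fintype.card A + nonunitCount A) * (Fintype.card A - nonunitCount A) := by ring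
  rw [hsq]
  induction l with
  | zero =>
    refine ⟨fun t ht => ?_, fun e he => ?_⟩
    · have : t ≠ 1 := by rintro rfl; exact ht isUnit_one
      simp [topCount_zero, this]
    · simp [topCount_zero, dotCount_zero, sub_eq_zero]
  | succ l ih =>
    obtain ⟨hz, hu⟩ := ih
    refine ⟨fun t ht => ?_, fun e he => ?_⟩
    · rw [mul_add, mul_one, topCount_add_two_of_not_isUnit _ hz ht]
      field_simp
      ring
    · rw [mul_add, mul_one, pow_succ, mul_neg_one,
        topCount_add_two_of_isUnit (2 * l) l (neg_one_pow_eq_or A l) hz hu he]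
      field_simp
      ring

end TopCount

/-! ### Dot products over `ZMod (p ^ m)` -/

section ZModPrimePow

theorem ZMod.pow_dvd_natCast_iff {p m j : ℕ} (hj : j ≤ m) (a : ℕ) :
    ((p : ZMod (p ^ m)) ^ j ∣ (a : ZMod (p ^ m))) ↔ p ^ j ∣ a := by
  constructor
  · intro h
    have h2 := map_dvd (ZMod.castHom (pow_dvd_pow p hj) (ZMod (p ^ j))) h
    rw [← Nat.cast_pow, map_natCast, map_natCast, ZMod.natCast_self, zero_dvd_iff] at h2
    exact (ZMod.natCast_eq_zero_iff _ _).1 h2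
  · rintro ⟨c, rfl⟩
    exact ⟨c, by push_cast; ring⟩

variable {p m : ℕ} [Fact p.Prime]

theorem ZMod.isUnit_iff_not_prime_dvd (hm : m ≠ 0) (a : ZMod (p ^ m)) :
    IsUnit a ↔ ¬ (p : ZMod (p ^ m)) ∣ a := by
  have : NeZero (p ^ m) := ⟨pow_ne_zero _ (Fact.out : p.Prime).ne_zero⟩
  obtain ⟨k, rfl⟩ := ZMod.natCast_zmod_surjective a
  have h := ZMod.pow_dvd_natCast_iff (p := p) (Nat.one_le_iff_ne_zero.2 hm) k
  rw [pow_one, pow_one] at h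
  rw [h, ZMod.isUnit_iff_coprime, Nat.coprime_pow_right_iff (Nat.pos_of_ne_zero hm),
    Nat.coprime_comm, (Fact.out : p.Prime).coprime_iff_not_dvd]

theorem ZMod.isLocalRing_prime_pow (hm : m ≠ 0) : IsLocalRing (ZMod (p ^ m)) := by
  have : Nontrivial (ZMod (p ^ m)) :=
    ZMod.nontrivial_iff.2 (Nat.one_lt_pow hm (Fact.out : p.Prime).one_lt).ne'
  refine IsLocalRing.of_nonunits_add fun a b ha hb => ?_
  simp only [mem_nonunits_iff, ZMod.isUnit_iff_not_prime_dvd hm, not_not] at *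
  exact dvd_add ha hb

theorem ZMod.card_span_prime_pow {j : ℕ} (hj : j ≤ m) :
    Nat.card (Ideal.span {(p : ZMod (p ^ m)) ^ j}) = p ^ (m - j) := by
  have hp := (Fact.out : p.Prime).pos
  have e : Nat.card (Ideal.span {(p : ZMod (p ^ m)) ^ j}) =
      Nat.card (AddSubgroup.zmultiples (((p ^ j : ℕ) : ZMod (p ^ m)))) := by
    refine Nat.card_congr (Equiv.subtypeEquivRight fun a => ?_)
    rw [Ideal.mem_span_singleton', AddSubgroup.mem_zmultiples_iff]
    constructor
    · rintro ⟨c, rfl⟩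
      obtain ⟨k, rfl⟩ := ZMod.intCast_surjective c
      exact ⟨k, by simp⟩
    · rintro ⟨k, rfl⟩
      exact ⟨k, by simp⟩
  rw [e, Nat.card_zmultiples, ZMod.addOrderOf_coe _ (pow_pos hp m).ne',
    Nat.gcd_eq_right (pow_dvd_pow p hj), Nat.pow_div hj hp]

variable [NeZero (p ^ m)]

theorem ZMod.sum_prime_pow_dvd {j : ℕ} (hj : j ≤ m) :
    ∑ a : ZMod (p ^ m), (open Classical in if (p : ZMod (p ^ m)) ^ j ∣ a then (1 : ℚ) else 0) =
      (p : ℚ) ^ (m - j) := by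
  classical
  have h := ZMod.card_span_prime_pow (p := p) hj
  simp only [← Ideal.mem_span_singleton]
  rw [Nat.card_eq_fintype_card, Fintype.card_subtype] at h
  rw [Finset.sum_boole, h, Nat.cast_pow]

theorem ZMod.nonunitCount_prime_pow (hm : m ≠ 0) :
    nonunitCount (ZMod (p ^ m)) = (p : ℚ) ^ (m - 1) := by
  classical
  rw [← ZMod.sum_prime_pow_dvd (Nat.one_le_iff_ne_zero.2 hm), nonunitCount]
  refine Fintype.sum_congr _ _ fun a => ?_
  simp only [ZMod.isUnit_iff_not_prime_dvd hm, pow_one, ite_not]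

theorem ZMod.sum_forall_prime_pow_dvd {j : ℕ} (hj : j ≤ m) (l : ℕ) :
    ∑ x : Fin l → ZMod (p ^ m),
      (open Classical in if ∀ i, (p : ZMod (p ^ m)) ^ j ∣ x i then (1 : ℚ) else 0) = ((p : ℚ) ^ (m - j)) ^ l := by
  classical
  rw [← ZMod.sum_prime_pow_dvd hj, Fintype.sum_pow]
  refine Fintype.sum_congr _ _ fun x => ?_
  rw [Finset.prod_ite_zero]
  simp

/-- A coordinate not divisible by `p ^ (j + 1)` is a unit times `p ^ j`. The second hypothesis is
restricted to `j < m` because for `j = m` all coordinates vanish and are divisible by every power.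
-/
theorem ZMod.span_range_eq_span_prime_pow {j l : ℕ} (x : Fin l → ZMod (p ^ m))
    (hx : ∀ i, (p : ZMod (p ^ m)) ^ j ∣ x i)
    (hx' : j < m → ¬ ∀ i, (p : ZMod (p ^ m)) ^ (j + 1) ∣ x i) (hj : j ≤ m) :
    Ideal.span (Set.range x) = Ideal.span {(p : ZMod (p ^ m)) ^ j} := by
  apply le_antisymm
  · rw [Ideal.span_le]
    rintro _ ⟨i, rfl⟩
    exact Ideal.mem_span_singleton.2 (hx i)
  · rw [Ideal.span_singleton_le_iff_mem]
    rcases hj.eq_or_lt with rfl | hlt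
    · rw [← Nat.cast_pow, ZMod.natCast_self]
      exact Ideal.zero_mem _
    · have h := hx' hlt
      push Not at h
      obtain ⟨i, hi⟩ := h
      obtain ⟨c, hc⟩ := hx i
      have hcu : IsUnit c := by
        rw [ZMod.isUnit_iff_not_prime_dvd (by omega)]
        rintro ⟨d, rfl⟩
        exact hi ⟨d, by rw [hc, pow_succ]; ring⟩
      obtain ⟨u, rfl⟩ := hcu
      have : (p : ZMod (p ^ m)) ^ j = ((u⁻¹ : (ZMod (p ^ m))ˣ) : ZMod (p ^ m)) * x i := by
        rw [hc, mul_comm, mul_assoc, Units.mul_inv, mul_one]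
      rw [this]
      exact Ideal.mul_mem_left _ _ (Ideal.subset_span ⟨i, rfl⟩)

-- The summand `j` comes from the `x` whose coordinates are all divisible by `p ^ j` but not all by
-- `p ^ (j + 1)`; the last term comes from `x = 0`.
open Classical in
theorem ZMod.dotCount_prime_pow (l : ℕ) (t : ZMod (p ^ m)) :
    dotCount l t = ∑ j ∈ Finset.range m, (((p : ℚ) ^ (m - j)) ^ l - ((p : ℚ) ^ (m - (j + 1))) ^ l) *
        (if (p : ZMod (p ^ m)) ^ j ∣ t then ((p : ℚ) ^ m) ^ l / (p : ℚ) ^ (m - j) else 0) +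
      if t = 0 then ((p : ℚ) ^ m) ^ l else 0 := by
  let c : (Fin l → ZMod (p ^ m)) → ℚ := fun x =>
    ∑ y : Fin l → ZMod (p ^ m), if ∑ i, x i * y i = t then (1 : ℚ) else 0
  have hc : ∀ (j : ℕ), j ≤ m → ∀ x : Fin l → ZMod (p ^ m),
      (∀ i, (p : ZMod (p ^ m)) ^ j ∣ x i) →
      (j < m → ¬ ∀ i, (p : ZMod (p ^ m)) ^ (j + 1) ∣ x i) →
      c x = if (p : ZMod (p ^ m)) ^ j ∣ t then ((p : ℚ) ^ m) ^ l / (p : ℚ) ^ (m - j) else 0 := by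
    intro j hj x hx hx'
    simp only [c]
    rw [sum_dot_eq, ZMod.span_range_eq_span_prime_pow x hx hx' hj, ZMod.card_span_prime_pow hj,
      ZMod.card]
    simp only [Ideal.mem_span_singleton]
    push_cast
    rfl
  -- `F j` keeps the `x` divisible by `p ^ j`, so `F j - F (j + 1)` isolates one stratum and the sum
  -- telescopes.
  let F : ℕ → ℚ := fun j => ∑ x : Fin l → ZMod (p ^ m),
    (if ∀ i, (p : ZMod (p ^ m)) ^ j ∣ x i then (1 : ℚ) else 0) * c x
  have h0 : dotCount l t = F 0 := by
    simp [F, c, dotCount]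
  have hm : F m = if t = 0 then ((p : ℚ) ^ m) ^ l else 0 := by
    have e : (p : ZMod (p ^ m)) ^ m = 0 := by rw [← Nat.cast_pow, ZMod.natCast_self]
    have : ∀ x : Fin l → ZMod (p ^ m),
        (if ∀ i, (p : ZMod (p ^ m)) ^ m ∣ x i then (1 : ℚ) else 0) * c x =
        (if ∀ i, (p : ZMod (p ^ m)) ^ m ∣ x i then (1 : ℚ) else 0) *
          (if t = 0 then ((p : ℚ) ^ m) ^ l else 0) := fun x => by
      split_ifs with h1 h2
      · rw [hc m le_rfl x h1 (fun h => absurd h (lt_irrefl _)), e, if_pos (by simp [h2])]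
        simp
      · rw [hc m le_rfl x h1 (fun h => absurd h (lt_irrefl _)), e, if_neg (by simpa using h2)]
      · simp
      · simp
    simp only [F]
    rw [Fintype.sum_congr _ _ this, ← Finset.sum_mul, ZMod.sum_forall_prime_pow_dvd le_rfl]
    simp
  have hstep : ∀ j ∈ Finset.range m, F j - F (j + 1) =
      (((p : ℚ) ^ (m - j)) ^ l - ((p : ℚ) ^ (m - (j + 1))) ^ l) *
        (if (p : ZMod (p ^ m)) ^ j ∣ t then ((p : ℚ) ^ m) ^ l / (p : ℚ) ^ (m - j) else 0) := by
    intro j hj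
    have hj := Finset.mem_range.1 hj
    rw [← ZMod.sum_forall_prime_pow_dvd hj.le, ← ZMod.sum_forall_prime_pow_dvd hj]
    simp only [F]
    rw [← Finset.sum_sub_distrib, ← Finset.sum_sub_distrib, Finset.sum_mul]
    refine Fintype.sum_congr _ _ fun x => ?_
    by_cases h2 : ∀ i, (p : ZMod (p ^ m)) ^ (j + 1) ∣ x i
    · have h1 : ∀ i, (p : ZMod (p ^ m)) ^ j ∣ x i := fun i =>
        (pow_dvd_pow _ (Nat.le_succ j)).trans (h2 i)
      rw [if_pos h1, if_pos h2]
      ring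
    · rw [if_neg h2]
      by_cases h1 : ∀ i, (p : ZMod (p ^ m)) ^ j ∣ x i
      · rw [if_pos h1, hc j hj.le x h1 fun _ => h2]
        ring
      · rw [if_neg h1]
        ring
  rw [← Finset.sum_congr rfl hstep, Finset.sum_range_sub', hm, h0]
  ring

end ZModPrimePow

/-! ### Closed forms over `ZMod (p ^ (k + 1))` -/

section ZModPrimePow

/-- The value of `topCount (2 * l)` over `ZMod (p ^ (k + 1))` at the unit `(-1) ^ l * (1 + t)`,
in terms of `dotCount l t`; see `topCount_two_mul`. -/
noncomputable def ZMod.unitTopCount (p k l : ℕ) [NeZero (p ^ (k + 1))]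
    (t : ZMod (p ^ (k + 1))) : ℚ :=
  dotCount l t + ((((p : ℚ) ^ (k + 1)) ^ (l + 1) - ((p : ℚ) ^ k) ^ (l + 1)) *
        (((p : ℚ) ^ (k + 1)) ^ l - ((p : ℚ) ^ k) ^ l) / (((p : ℚ) ^ (k + 1)) ^ 2 - ((p : ℚ) ^ k) ^ 2) -
        (((p : ℚ) ^ (k + 1)) ^ l - ((p : ℚ) ^ k) ^ l) * (((p : ℚ) ^ (k + 1)) ^ l / (p : ℚ) ^ (k + 1)))

variable {p k : ℕ} [Fact p.Prime]

/-- Every stratum contributes at `t = 0`, giving a geometric sum of ratio `p ^ (l - 1)`, which is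
not `1` since `2 ≤ l`. -/
theorem ZMod.dotCount_prime_pow_zero {l : ℕ} (hl : 2 ≤ l) [NeZero (p ^ (k + 1))] :
    dotCount l (0 : ZMod (p ^ (k + 1))) = ((p : ℚ) ^ (k + 1)) ^ l *
      (((p : ℚ) ^ l - 1) / p * ((((p : ℚ) ^ (l - 1)) ^ (k + 1) - 1) / ((p : ℚ) ^ (l - 1) - 1)) + 1) := by
  have hp : (p : ℚ) ≠ 0 := by exact_mod_cast (Fact.out : p.Prime).ne_zero
  have hp1 : (1 : ℚ) < p := by exact_mod_cast (Fact.out : p.Prime).one_lt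
  have hr : (p : ℚ) ^ (l - 1) ≠ 1 := (one_lt_pow₀ hp1 (by omega)).ne'
  rw [ZMod.dotCount_prime_pow, if_pos rfl, ← geom_sum_eq hr, Finset.mul_sum,
    ← Finset.sum_range_reflect, mul_add, mul_one, Finset.mul_sum]
  congr 1
  refine Finset.sum_congr rfl fun i hi => ?_
  have hi := Finset.mem_range.1 hi
  rw [if_pos (dvd_zero _), show k + 1 - (k + 1 - 1 - i) = i + 1 by omega,
    show k + 1 - (k + 1 - 1 - i + 1) = i by omega]
  obtain ⟨l, rfl⟩ : ∃ l', l = l' + 1 := ⟨l - 1, by omega⟩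
  rw [Nat.add_sub_cancel]
  field_simp
  ring

theorem ZMod.unitTopCount_zero {l : ℕ} (hl : 2 ≤ l) [NeZero (p ^ (k + 1))] :
    ZMod.unitTopCount p k l 0 =
      (p : ℚ) ^ (k * (2 * l - 1)) *
          (((p : ℚ) ^ (l + 1) - 1) * ((p : ℚ) ^ l - 1) / ((p : ℚ) ^ 2 - 1) + (p : ℚ) ^ l)
        + ((p : ℚ) ^ (k * (2 * l - 1 - l)) - 1) / ((p : ℚ) ^ (2 * l - 1 - l) - 1)
          * (p : ℚ) ^ ((k + 1) * l - 1) * ((p : ℚ) - 1) := by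
  have hp : (p : ℚ) ≠ 0 := by exact_mod_cast (Fact.out : p.Prime).ne_zero
  have hp1 : (1 : ℚ) < p := by exact_mod_cast (Fact.out : p.Prime).one_lt
  have hr : (p : ℚ) ^ (l - 1) - 1 ≠ 0 := sub_ne_zero.2 (one_lt_pow₀ hp1 (by omega)).ne'
  have h2 : (p : ℚ) ^ 2 - 1 ≠ 0 := sub_ne_zero.2 (one_lt_pow₀ hp1 (by omega)).ne'
  rw [ZMod.unitTopCount, ZMod.dotCount_prime_pow_zero hl, show 2 * l - 1 - l = l - 1 by omega]
  obtain ⟨l, rfl⟩ : ∃ l', l = l' + 1 := ⟨l - 1, by omega⟩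
  rw [Nat.add_sub_cancel] at *
  rw [show 2 * (l + 1) - 1 = l + l + 1 by omega,
    show (k + 1) * (l + 1) - 1 = k * l + k + l by rw [add_mul, mul_add]; omega]
  have h3 : ((p : ℚ) ^ (k + 1)) ^ 2 - ((p : ℚ) ^ k) ^ 2 = ((p : ℚ) ^ k) ^ 2 * ((p : ℚ) ^ 2 - 1) := by
    ring
  have hq : (p : ℚ) ^ k ≠ 0 := pow_ne_zero _ hp
  rw [h3]
  -- All powers are expressed through `p ^ (k * l)`, `p ^ k`, `p ^ l` and `p`, so that an identity
  -- of rational functions remains.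
  have e1 : ((p : ℚ) ^ (k + 1)) ^ (l + 1) = p ^ (k * l) * p ^ k * p ^ l * p := by ring
  have e2 : ((p : ℚ) ^ (k + 1)) ^ (l + 1 + 1) = p ^ (k * l) * (p ^ k) ^ 2 * p ^ l * p ^ 2 := by ring
  have e3 : ((p : ℚ) ^ k) ^ (l + 1) = p ^ (k * l) * p ^ k := by ring
  have e4 : ((p : ℚ) ^ k) ^ (l + 1 + 1) = p ^ (k * l) * (p ^ k) ^ 2 := by ring
  have e5 : (p : ℚ) ^ (k * (l + l + 1)) = (p ^ (k * l)) ^ 2 * p ^ k := by ring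
  have e6 : (p : ℚ) ^ (k * l + k + l) = p ^ (k * l) * p ^ k * p ^ l := by ring
  have e7 : ((p : ℚ) ^ l) ^ (k + 1) = p ^ (k * l) * p ^ l := by ring
  have e8 : (p : ℚ) ^ (l + 1 + 1) = p ^ l * p ^ 2 := by ring
  rw [e1, e2, e3, e4, e5, e6, e7, e8, pow_succ (p : ℚ) k, pow_succ (p : ℚ) l]
  generalize (p : ℚ) ^ (k * l) = X at *
  generalize (p : ℚ) ^ k = q at *
  generalize (p : ℚ) ^ l = L at *
  field_simp
  ring

theorem ZMod.unitTopCount_of_isUnit (l : ℕ) [NeZero (p ^ (k + 1))] {t : ZMod (p ^ (k + 1))}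
    (ht : IsUnit t) (hl : l ≠ 0) :
    ZMod.unitTopCount p k l t =
      (p : ℚ) ^ (k * (2 * l - 1)) * ((p : ℚ) ^ (l + 1) - 1) * ((p : ℚ) ^ l - 1)
        / ((p : ℚ) ^ 2 - 1) := by
  have := ZMod.isLocalRing_prime_pow (p := p) (Nat.succ_ne_zero k)
  have hp : (p : ℚ) ≠ 0 := by exact_mod_cast (Fact.out : p.Prime).ne_zero
  have hp1 : (1 : ℚ) < p := by exact_mod_cast (Fact.out : p.Prime).one_lt
  have h2 : (p : ℚ) ^ 2 - 1 ≠ 0 := sub_ne_zero.2 (one_lt_pow₀ hp1 (by omega)).ne'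
  rw [ZMod.unitTopCount, dotCount_of_isUnit l ht, ZMod.card, ZMod.nonunitCount_prime_pow (Nat.succ_ne_zero k)]
  simp only [Nat.succ_eq_add_one, Nat.add_sub_cancel]
  push_cast
  rw [add_sub_cancel]
  obtain ⟨l, rfl⟩ : ∃ l', l = l' + 1 := ⟨l - 1, by omega⟩
  rw [show 2 * (l + 1) - 1 = l + l + 1 by omega]
  have h3 : ((p : ℚ) ^ (k + 1)) ^ 2 - ((p : ℚ) ^ k) ^ 2 = ((p : ℚ) ^ k) ^ 2 * ((p : ℚ) ^ 2 - 1) := by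
    ring
  rw [h3]
  field_simp
  ring

theorem ZMod.w_prime_pow_one_and_neg_one (l : ℕ) [NeZero (p ^ (k + 1))] :
    (Even l → (w (2 * l + 2) (1 : (ZMod (p ^ (k + 1)))ˣ) : ℚ) =
        ZMod.unitTopCount p k l (-2) ∧
      (w (2 * l + 2) (-1 : (ZMod (p ^ (k + 1)))ˣ) : ℚ) =
        ZMod.unitTopCount p k l 0) ∧
    (Odd l → (w (2 * l + 2) (1 : (ZMod (p ^ (k + 1)))ˣ) : ℚ) =
        ZMod.unitTopCount p k l 0 ∧
      (w (2 * l + 2) (-1 : (ZMod (p ^ (k + 1)))ˣ) : ℚ) =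
        ZMod.unitTopCount p k l (-2)) := by
  have := ZMod.isLocalRing_prime_pow (p := p) (Nat.succ_ne_zero k)
  have h := (topCount_two_mul (A := ZMod (p ^ (k + 1))) l).2
  simp only [ZMod.card, ZMod.nonunitCount_prime_pow (p := p) (Nat.succ_ne_zero k), Nat.cast_pow,
    Nat.succ_eq_add_one, Nat.add_sub_cancel] at h
  replace h : ∀ e : ZMod (p ^ (k + 1)), IsUnit e →
      topCount (2 * l) ((-1) ^ l * e) = ZMod.unitTopCount p k l (e - 1) := h
  -- The corner `-u⁻¹` is `-1` or `1`; the parity of `l` decides which of `e = 1` (`t = 0`) and `e =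
  -- -1` (`t = -2`) it matches.
  have h1 := h 1 isUnit_one
  have h2 := h (-1) isUnit_one.neg
  rw [sub_self] at h1
  rw [show (-1 - 1 : ZMod (p ^ (k + 1))) = -2 by ring] at h2
  constructor
  · intro hl
    rw [hl.neg_one_pow, one_mul] at h1 h2
    rw [w_eq_topCount, w_eq_topCount, ← h1, ← h2]
    simp
  · intro hl
    rw [hl.neg_one_pow, neg_one_mul] at h1 h2
    rw [w_eq_topCount, w_eq_topCount, ← h1, ← h2]
    simp

end ZModPrimePow

/-! ### The value at `-2`, the prime `2`, and the final formulas -/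

theorem ZMod.isUnit_neg_two_of_odd {n : ℕ} (hn : Odd n) : IsUnit (-2 : ZMod n) := by
  rw [IsUnit.neg_iff]
  exact_mod_cast (ZMod.isUnit_iff_coprime 2 n).2 (Nat.coprime_two_left.2 hn)

theorem ZMod.unitTopCount_two_neg_two {k l : ℕ} (hl : l ≠ 0) [NeZero (2 ^ (k + 1 + 1))] :
    ZMod.unitTopCount 2 (k + 1) l (-2) =
      (2 : ℚ) ^ (k * (2 * l - 1)) * (((4 : ℚ) ^ (2 * l) - (2 : ℚ) ^ (2 * l)) / 3) := by
  have : Fact (Nat.Prime 2) := ⟨Nat.prime_two⟩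
  have hdvd : ∀ j, j ≤ k + 1 + 1 → (((2 : ℕ) : ZMod (2 ^ (k + 1 + 1))) ^ j ∣ -2 ↔ j ≤ 1) := fun j hj => by
    have h := ZMod.pow_dvd_natCast_iff (p := 2) hj 2
    rw [show (-2 : ZMod (2 ^ (k + 1 + 1))) = -((2 : ℕ) : ZMod (2 ^ (k + 1 + 1))) by norm_num,
      dvd_neg, h]
    exact Nat.pow_dvd_pow_iff_le_right (x := 2) (l := 1) (by norm_num)
  have h0 : (-2 : ZMod (2 ^ (k + 1 + 1))) ≠ 0 := fun h => by
    have h1 := (hdvd 2 (by omega)).1 (h ▸ dvd_zero _)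
    omega
  -- Only `j = 0` and `j = 1` survive, as `4` does not divide `-2` here; they are split off from the
  -- sum.
  rw [ZMod.unitTopCount, ZMod.dotCount_prime_pow, if_neg h0, Finset.sum_range_succ', Finset.sum_range_succ', Finset.sum_eq_zero,
    if_pos ((hdvd _ (by omega)).2 (by omega)), if_pos ((hdvd _ (by omega)).2 (by omega))]
  · obtain ⟨l, rfl⟩ : ∃ l', l = l' + 1 := ⟨l - 1, by omega⟩
    rw [show 2 * (l + 1) - 1 = l + l + 1 by omega]
    have h4 : (4 : ℚ) ^ (2 * (l + 1)) = 2 ^ l * 2 ^ l * 2 ^ l * 2 ^ l * 16 := by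
      rw [show (4 : ℚ) = 2 ^ 2 by norm_num, ← pow_mul]
      ring
    have h3 : ((2 : ℚ) ^ (k + 1 + 1)) ^ 2 - ((2 : ℚ) ^ (k + 1)) ^ 2 = ((2 : ℚ) ^ k) ^ 2 * 12 := by
      ring
    push_cast
    rw [h3, h4]
    simp only [← pow_mul]
    field_simp
    ring
  · intro j hj
    have hj := Finset.mem_range.1 hj
    rw [if_neg, mul_zero]
    rw [hdvd _ (by omega)]
    omega

/-- The general formula at `0` also holds for `p = 2`. This form moves the top term of its geometric
sum into the main term. -/
theorem ZMod.unitTopCount_two_zero {k l : ℕ} (hl : 2 ≤ l) [NeZero (2 ^ (k + 1 + 1))] :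
    ZMod.unitTopCount 2 (k + 1) l 0 =
      (2 : ℚ) ^ (k * (2 * l - 1)) * (((4 : ℚ) ^ (2 * l) + (2 : ℚ) ^ (2 * l + 1)) / 3)
        + ((2 : ℚ) ^ (k * (2 * l - 1 - l)) - 1) / ((2 : ℚ) ^ (2 * l - 1 - l) - 1)
          * (2 : ℚ) ^ ((k + 2) * l - 1) := by
  have : Fact (Nat.Prime 2) := ⟨Nat.prime_two⟩
  rw [ZMod.unitTopCount_zero hl, Nat.cast_ofNat, show 2 * l - 1 - l = l - 1 by omega]
  obtain ⟨l, rfl⟩ : ∃ l', l = l' + 1 := ⟨l - 1, by omega⟩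
  have h4 : (4 : ℚ) ^ (2 * (l + 1)) = 2 ^ l * 2 ^ l * 2 ^ l * 2 ^ l * 16 := by
    rw [show (4 : ℚ) = 2 ^ 2 by norm_num, ← pow_mul]
    ring
  have hr : (2 : ℚ) ^ l - 1 ≠ 0 :=
    sub_ne_zero.2 (one_lt_pow₀ (by norm_num : (1 : ℚ) < 2) (by omega)).ne'
  rw [Nat.add_sub_cancel, show 2 * (l + 1) - 1 = l + l + 1 by omega, show k + 1 + 1 = k + 2 from rfl,
    show (k + 2) * (l + 1) - 1 = k * l + k + l + l + 1 by rw [add_mul, mul_add]; omega, h4]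
  field_simp
  ring

theorem theorem4 :
    (∀ p m n l : ℕ, p.Prime → Odd p → 2 ≤ m → n = 2 * l → 4 ≤ n →
      (Even l →
        (w (n + 2) (1 : (ZMod (p ^ m))ˣ) : ℚ) =
            (p : ℚ) ^ ((m - 1) * (n - 1)) * ((p : ℚ) ^ (l + 1) - 1) * ((p : ℚ) ^ l - 1)
              / ((p : ℚ) ^ 2 - 1) ∧
        (w (n + 2) (-1 : (ZMod (p ^ m))ˣ) : ℚ) =
            (p : ℚ) ^ ((m - 1) * (n - 1)) *
                (((p : ℚ) ^ (l + 1) - 1) * ((p : ℚ) ^ l - 1) / ((p : ℚ) ^ 2 - 1) + (p : ℚ) ^ l)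
              + ((p : ℚ) ^ ((m - 1) * (n - 1 - l)) - 1) / ((p : ℚ) ^ (n - 1 - l) - 1)
                * (p : ℚ) ^ (m * l - 1) * ((p : ℚ) - 1)) ∧
      (Odd l →
        (w (n + 2) (1 : (ZMod (p ^ m))ˣ) : ℚ) =
            (p : ℚ) ^ ((m - 1) * (n - 1)) *
                (((p : ℚ) ^ (l + 1) - 1) * ((p : ℚ) ^ l - 1) / ((p : ℚ) ^ 2 - 1) + (p : ℚ) ^ l)
              + ((p : ℚ) ^ ((m - 1) * (n - 1 - l)) - 1) / ((p : ℚ) ^ (n - 1 - l) - 1)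
                * (p : ℚ) ^ (m * l - 1) * ((p : ℚ) - 1) ∧
        (w (n + 2) (-1 : (ZMod (p ^ m))ˣ) : ℚ) =
            (p : ℚ) ^ ((m - 1) * (n - 1)) * ((p : ℚ) ^ (l + 1) - 1) * ((p : ℚ) ^ l - 1)
              / ((p : ℚ) ^ 2 - 1))) ∧
    (∀ m n l : ℕ, 3 ≤ m → n = 2 * l → 4 ≤ n →
      (Even l →
        (w (n + 2) (1 : (ZMod (2 ^ m))ˣ) : ℚ) =
            (2 : ℚ) ^ ((m - 2) * (n - 1)) * (((4 : ℚ) ^ n - (2 : ℚ) ^ n) / 3) ∧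
        (w (n + 2) (-1 : (ZMod (2 ^ m))ˣ) : ℚ) =
            (2 : ℚ) ^ ((m - 2) * (n - 1)) * (((4 : ℚ) ^ n + (2 : ℚ) ^ (n + 1)) / 3)
              + ((2 : ℚ) ^ ((m - 2) * (n - 1 - l)) - 1) / ((2 : ℚ) ^ (n - 1 - l) - 1)
                * (2 : ℚ) ^ (m * l - 1)) ∧
      (Odd l →
        (w (n + 2) (1 : (ZMod (2 ^ m))ˣ) : ℚ) =
            (2 : ℚ) ^ ((m - 2) * (n - 1)) * (((4 : ℚ) ^ n + (2 : ℚ) ^ (n + 1)) / 3)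
              + ((2 : ℚ) ^ ((m - 2) * (n - 1 - l)) - 1) / ((2 : ℚ) ^ (n - 1 - l) - 1)
                * (2 : ℚ) ^ (m * l - 1) ∧
        (w (n + 2) (-1 : (ZMod (2 ^ m))ˣ) : ℚ) =
            (2 : ℚ) ^ ((m - 2) * (n - 1)) * (((4 : ℚ) ^ n - (2 : ℚ) ^ n) / 3))) := by

  constructor
  · rintro p m n l hp hodd hm rfl hn
    obtain ⟨k, rfl⟩ : ∃ k, m = k + 1 := ⟨m - 1, by omega⟩
    have : Fact p.Prime := ⟨hp⟩
    have : NeZero (p ^ (k + 1)) := ⟨pow_ne_zero _ hp.ne_zero⟩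
    have h := ZMod.w_prime_pow_one_and_neg_one (p := p) (k := k) l
    rw [ZMod.unitTopCount_zero (by omega),
      ZMod.unitTopCount_of_isUnit l (ZMod.isUnit_neg_two_of_odd hodd.pow) (by omega)] at h
    exact h
  · rintro m n l hm rfl hn
    obtain ⟨k, rfl⟩ : ∃ k, m = k + 1 + 1 := ⟨m - 2, by omega⟩
    have : Fact (Nat.Prime 2) := ⟨Nat.prime_two⟩
    have : NeZero (2 ^ (k + 1 + 1)) := ⟨pow_ne_zero _ two_ne_zero⟩
    have h := ZMod.w_prime_pow_one_and_neg_one (p := 2) (k := k + 1) l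
    rw [ZMod.unitTopCount_two_zero (by omega), ZMod.unitTopCount_two_neg_two (by omega)] at h
    exact h
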